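/- For $f\colon\{-1,1\}^n\to\{0,1\}$ let $\mathbb{E}[f]$ be the expectation of $f(x)$ for $x$ uniform in $\{-1,1\}^n$, let $W^1(f)=\sum_{i=1}^n \mathbb{E}[f(x)x_i]^2$ be its first-degree Fourier weight, and for $\rho\in[0,1]$ let $\mathbb{S}_\rho(f)=\mathrm{Cov}(f(x),f(y))$ be its noise stability, where $x$ is uniform in $\{-1,1\}^n$ and $y$ is obtained from $x$ by independently keeping each coordinate unchanged with probability $\rho$ and replacing it by a uniformly random element of $\{-1,1\}$ with probability $1-\rho$. A halfspace is a function $g(x)=\mathbb{1}\left(\sum_i a_i x_i>t\right)$ on $\{-1,1\}^n$ with $a\in\mathbb{R}^n$, $t\in\mathbb{R}$. Covariances $\mathrm{Cov}(f,g)$ are with respect to the uniform measure, and $\log$ is the natural logarithm. There exists a universal constant $c\in(0,\log 2]$ such that for every $\kappa>0$ there are constants $c_1,c_2>0$, depending only on $\kappa$, with the following property. For every $n$ and every monotone (coordinatewise non-decreasing) function $f\colon\{-1,1\}^n\to\{0,1\}$ with $0<\mathbb{E}[f]\le\frac12$, if $$\mathbb{S}_{c/\log(1/\mathbb{E}[f])}(f)\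 \ge\ \kappa\,\mathbb{E}[f]^2,$$ then $$W^1(f)\ \ge\ c_1\,\mathbb{E}[f]^2\log(1/\mathbb{E}[f]),$$ and consequently there exists a halfspace $g$ with $\mathrm{Cov}(f,g)\ \ge\ c_2\,\mathbb{E}[f]$. -/

import Mathlib

open scoped BigOperators

namespace BooleanCube

/-- The discrete cube `{-1,1}^n`, with the coordinatewise order (`-1 ≤ 1`). -/
abbrev Cube (n : ℕ) : Type := Fin n → ℤˣ

/-- The real number `x_i ∈ {-1,1}`. -/
def coord {n : ℕ} (x : Cube n) (i : Fin n) : ℝ := ((x i : ℤ) : ℝ)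

/-- A real function on the cube which takes only the values `0` and `1`. -/
def IsBoolean {n : ℕ} (f : Cube n → ℝ) : Prop := ∀ x, f x = 0 ∨ f x = 1

/-- The expectation of `f x`, for `x` uniform in the cube. -/
noncomputable def mean {n : ℕ} (f : Cube n → ℝ) : ℝ := (∑ x, f x) / 2 ^ n

/-- The covariance of `f x` and `g x`, for `x` uniform in the cube. -/
noncomputable def cov {n : ℕ} (f g : Cube n → ℝ) : ℝ :=
  mean (fun x => f x * g x) - mean f * mean g

/-- The Fourier coefficient of `f` at `S`, namely the expectation of `f x * ∏ i ∈ S, x_i`. -/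
noncomputable def fourierCoeff {n : ℕ} (f : Cube n → ℝ) (S : Finset (Fin n)) : ℝ :=
  mean (fun x => f x * ∏ i ∈ S, coord x i)

/-- The degree-`k` Fourier weight: the sum of the squared coefficients over all `S` of size `k`. -/
noncomputable def fourierWeight {n : ℕ} (k : ℕ) (f : Cube n → ℝ) : ℝ :=
  ∑ S ∈ Finset.powersetCard k Finset.univ, fourierCoeff f S ^ 2

/-- The conditional probability of `y` given `x` when, independently for each coordinate, `x_i` is
kept with probability `ρ` and replaced by a uniform element of `{-1,1}` with probability `1 - ρ`. -/
noncomputable def noiseKernel {n : ℕ} (ρ : ℝ) (x y : Cube n) : ℝ :=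
  ∏ i, (ρ * (if y i = x i then 1 else 0) + (1 - ρ) * (1 / 2))

/-- The expectation of `F x y`, for `x` uniform in the cube and `y` its noisy copy. -/
noncomputable def noiseMean {n : ℕ} (ρ : ℝ) (F : Cube n → Cube n → ℝ) : ℝ :=
  mean (fun x => ∑ y, noiseKernel ρ x y * F x y)

/-- The noise stability of `f` at noise rate `1 - ρ`: the covariance of `f x` and `f y`, for `x`
uniform in the cube and `y` its noisy copy. -/
noncomputable def noiseStability {n : ℕ} (ρ : ℝ) (f : Cube n → ℝ) : ℝ :=
  noiseMean ρ (fun x y => f x * f y) -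
    noiseMean ρ (fun x _ => f x) * noiseMean ρ (fun _ y => f y)

/-- The halfspaces: the indicators of `∑ i, a_i x_i > t`, with `a ∈ ℝ^n` and `t ∈ ℝ`. -/
def IsHalfspace {n : ℕ} (g : Cube n → ℝ) : Prop :=
  ∃ (a : Fin n → ℝ) (t : ℝ), ∀ x,
    ((∑ i, a i * coord x i > t) → g x = 1) ∧ (¬ (∑ i, a i * coord x i > t) → g x = 0)

end BooleanCube

/-!
Why the theorem is true. Write `μ = E f`, `L = log (1 / μ)`, `w = W¹(f)`, and let `ρ = c / L`.

*Fourier weight.* The noise stability is `∑_{S ≠ ∅} ρ^#S f̂(S)²` (`noiseStability_eq`). Averaging over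
a random set `I` of coordinates bounds it by `2 ρ` times the average of
`∑_{i ∈ I} ∑_{T ⊆ Iᶜ} (2ρ)^#T f̂(T ∪ {i})²` (`noiseStability_le_sum_splitWeight`). For fixed `I` and
`i ∈ I`, the inner sum is the squared norm of a noisy version of `gᵢ(y) = E[f(x_I, y_{Iᶜ}) xᵢ]`.
Since `f` is monotone, `gᵢ ≥ 0`, so its `L¹` norm is its mean `f̂({i})`. Hypercontractivity
(`mean_noise_pow_le`) and Hölder's inequality then give, for an exponent `k` with
`2ρ (2k - 1) ≤ 1`, the bound `f̂({i})^{2(1 - 1/k)} (E gᵢ²)^{1/k}` for the inner sum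
(`sum_pow_card_mul_sq_pow_le`). Now sum over `i ∈ I`. The decoupling into `I` and `Iᶜ` ensures
`∑ E gᵢ² ≤ E f² = μ`, while the total influence of `f` has no such bound; hence Hölder's inequality
yields `S_ρ(f) ≤ 2ρ w^{1 - 1/k} μ^{1/k}` (`noiseStability_pow_le`). With `k` of order `L`, the powers
`μ^{1/k}` are bounded below by a constant, and `S_ρ(f) ≥ κ μ²` forces `w ≥ c₁ μ² L`
(`fourierWeight_ge`).

*Halfspace.* Let `Z = ∑ f̂({i}) xᵢ / √w`. Then `Cov(f, Z) = √w ≥ √c₁ μ √L`. Truncate `Z` at a height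
`T` of order `√L`. The truncated covariance is the integral over `t ∈ [-T, T]` of the covariances of
`f` with the halfspaces `Z > t`, and the error is at most a multiple of `exp(-T²/2)` because `Z` is
subgaussian; so some `t` has covariance of order at least `√w / T`, that is `μ`
(`sqrt_fourierWeight_le`, `exists_halfspace`).
-/

open scoped BigOperators

namespace BooleanCube

variable {n : ℕ}

/-! ### Walsh characters and sign changes -/

/-- The Walsh character `∏ i ∈ S, x_i`. -/
noncomputable def walsh (S : Finset (Fin n)) (x : Cube n) : ℝ := ∏ i ∈ S, coord x i

/-- The point `x` with the sign of its coordinate `i` changed. -/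
def flip (i : Fin n) (x : Cube n) : Cube n := Function.update x i (-x i)

lemma coord_eq (x : Cube n) (i : Fin n) :
    (x i = 1 ∧ coord x i = 1) ∨ (x i = -1 ∧ coord x i = -1) := by
  rcases Int.units_eq_one_or (x i) with h | h <;> simp [coord, h]

lemma coord_mul_self (x : Cube n) (i : Fin n) : coord x i * coord x i = 1 := by
  rcases coord_eq x i with ⟨-, h⟩ | ⟨-, h⟩ <;> rw [h] <;> norm_num

lemma coord_flip_self (x : Cube n) (i : Fin n) : coord (flip i x) i = -coord x i := by
  simp [coord, flip]

lemma coord_flip_of_ne (x : Cube n) {i j : Fin n} (h : j ≠ i) :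
    coord (flip i x) j = coord x j := by
  simp [coord, flip, h]

lemma flip_flip (i : Fin n) (x : Cube n) : flip i (flip i x) = x := by
  funext j
  by_cases h : j = i
  · subst h; simp [flip]
  · simp [flip, h]

lemma walsh_flip_of_notMem {S : Finset (Fin n)} {i : Fin n} (h : i ∉ S) (x : Cube n) :
    walsh S (flip i x) = walsh S x :=
  Finset.prod_congr rfl fun _ hj => coord_flip_of_ne x (fun e => h (e ▸ hj))

lemma walsh_insert {S : Finset (Fin n)} {i : Fin n} (h : i ∉ S) (x : Cube n) :
    walsh (insert i S) x = coord x i * walsh S x := by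
  simp [walsh, Finset.prod_insert h]

lemma walsh_flip_of_mem {S : Finset (Fin n)} {i : Fin n} (h : i ∈ S) (x : Cube n) :
    walsh S (flip i x) = -walsh S x := by
  rw [← Finset.insert_erase h, walsh_insert (Finset.notMem_erase i S),
    walsh_insert (Finset.notMem_erase i S), walsh_flip_of_notMem (Finset.notMem_erase i S),
    coord_flip_self, neg_mul]

lemma walsh_mul_self (S : Finset (Fin n)) (x : Cube n) : walsh S x * walsh S x = 1 := by
  rw [walsh, ← Finset.prod_mul_distrib]
  exact Finset.prod_eq_one fun i _ => coord_mul_self x i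

/-! ### The uniform expectation -/

lemma mean_sum {ι : Type*} (s : Finset ι) (F : ι → Cube n → ℝ) :
    mean (fun x => ∑ j ∈ s, F j x) = ∑ j ∈ s, mean (F j) := by
  simp only [mean, Finset.sum_div]
  rw [Finset.sum_comm]

lemma mean_add (F G : Cube n → ℝ) : mean (fun x => F x + G x) = mean F + mean G := by
  simp only [mean, Finset.sum_add_distrib, add_div]

lemma mean_sub (F G : Cube n → ℝ) : mean (fun x => F x - G x) = mean F - mean G := by
  simp only [mean, Finset.sum_sub_distrib, sub_div]

lemma mean_const_mul (r : ℝ) (F : Cube n → ℝ) : mean (fun x => r * F x) = r * mean F := by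
  simp only [mean, ← Finset.mul_sum, mul_div_assoc]

lemma mean_mul_const (r : ℝ) (F : Cube n → ℝ) : mean (fun x => F x * r) = mean F * r := by
  simp only [mean, ← Finset.sum_mul]; ring

lemma mean_const (r : ℝ) : mean (fun _ : Cube n => r) = r := by
  simp [mean]

lemma mean_mono {F G : Cube n → ℝ} (h : ∀ x, F x ≤ G x) : mean F ≤ mean G :=
  div_le_div_of_nonneg_right (Finset.sum_le_sum fun x _ => h x) (by positivity)

lemma mean_nonneg {F : Cube n → ℝ} (h : ∀ x, 0 ≤ F x) : 0 ≤ mean F :=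
  div_nonneg (Finset.sum_nonneg fun x _ => h x) (by positivity)

lemma mean_flip (i : Fin n) (F : Cube n → ℝ) : mean (fun x => F (flip i x)) = mean F := by
  unfold mean
  congr 1
  exact Equiv.sum_comp (Function.Involutive.toPerm (flip i) (flip_flip i)) F

lemma mean_walsh_mul_walsh (S T : Finset (Fin n)) :
    mean (fun x => walsh S x * walsh T x) = if S = T then 1 else 0 := by
  split_ifs with h
  · subst h
    simp only [walsh_mul_self, mean_const]
  · -- flipping a coordinate that lies in exactly one of the two sets changes the sign
    obtain ⟨i, hi⟩ : ∃ i, ¬ (i ∈ S ↔ i ∈ T) := by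
      by_contra! hc
      exact h (Finset.ext hc)
    have hf : ∀ x : Cube n, walsh S (flip i x) * walsh T (flip i x)
        = (-1) * (walsh S x * walsh T x) := by
      intro x
      by_cases hS : i ∈ S
      · have hT : i ∉ T := fun hT => hi ⟨fun _ => hT, fun _ => hS⟩
        rw [walsh_flip_of_mem hS, walsh_flip_of_notMem hT]; ring
      · have hT : i ∈ T := by
          by_contra hT
          exact hi ⟨fun h => absurd h hS, fun h => absurd h hT⟩
        rw [walsh_flip_of_notMem hS, walsh_flip_of_mem hT]; ring
    have := mean_flip i (fun x : Cube n => walsh S x * walsh T x)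
    simp only [hf] at this
    rw [mean_const_mul] at this
    linarith

/-- Parseval's identity for two Walsh polynomials given by their coefficients. -/
lemma mean_walshSum_mul_walshSum (P : Finset (Finset (Fin n))) (a b : Finset (Fin n) → ℝ) :
    mean (fun x => (∑ S ∈ P, a S * walsh S x) * ∑ S ∈ P, b S * walsh S x)
      = ∑ S ∈ P, a S * b S := by
  have h : ∀ x : Cube n, (∑ S ∈ P, a S * walsh S x) * ∑ S ∈ P, b S * walsh S x
      = ∑ S ∈ P, ∑ T ∈ P, (a S * b T) * (walsh S x * walsh T x) := by
    intro x
    rw [Finset.sum_mul_sum]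
    exact Finset.sum_congr rfl fun S _ => Finset.sum_congr rfl fun T _ => by ring
  simp only [h, mean_sum, mean_const_mul, mean_walsh_mul_walsh]
  refine Finset.sum_congr rfl fun S hS => ?_
  simp [hS]

lemma mean_walshSum (P : Finset (Finset (Fin n))) (hP : ∅ ∈ P) (a : Finset (Fin n) → ℝ) :
    mean (fun x => ∑ S ∈ P, a S * walsh S x) = a ∅ := by
  have h : ∀ S, mean (walsh S : Cube n → ℝ) = if S = ∅ then 1 else 0 := by
    intro S
    rw [← mean_walsh_mul_walsh]
    congr 1
    funext x
    simp [walsh]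
  simp only [mean_sum, mean_const_mul, h]
  simp [hP]

/-! ### Noise stability in terms of Fourier coefficients -/

lemma noiseKernel_eq (ρ : ℝ) (x y : Cube n) :
    noiseKernel ρ x y = (∑ S, ρ ^ S.card * (walsh S x * walsh S y)) / 2 ^ n := by
  have h : ∀ i : Fin n, ρ * (if y i = x i then 1 else 0) + (1 - ρ) * (1 / 2)
      = (1 + ρ * (coord x i * coord y i)) / 2 := by
    intro i
    rcases coord_eq x i with ⟨hx, hx'⟩ | ⟨hx, hx'⟩ <;>
      rcases coord_eq y i with ⟨hy, hy'⟩ | ⟨hy, hy'⟩ <;> rw [hx, hx', hy, hy']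
    · simp; ring
    · rw [if_neg (by decide)]; ring
    · rw [if_neg (by decide)]; ring
    · simp; ring
  rw [noiseKernel, Finset.prod_congr rfl fun i _ => h i, Finset.prod_div_distrib,
    Finset.prod_one_add]
  simp [walsh, Finset.prod_mul_distrib]

lemma noiseMean_mul (ρ : ℝ) (F G : Cube n → ℝ) :
    noiseMean ρ (fun x y => F x * G y)
      = ∑ S, ρ ^ S.card * (fourierCoeff F S * fourierCoeff G S) := by
  have h : ∀ x : Cube n, ∑ y, noiseKernel ρ x y * (F x * G y)
      = ∑ S, (ρ ^ S.card * fourierCoeff G S) * (F x * walsh S x) := by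
    intro x
    have : ∀ y : Cube n, noiseKernel ρ x y * (F x * G y)
        = ∑ S, (ρ ^ S.card * (F x * walsh S x)) * (G y * walsh S y / 2 ^ n) := by
      intro y
      rw [noiseKernel_eq, Finset.sum_div, Finset.sum_mul]
      exact Finset.sum_congr rfl fun S _ => by ring
    simp only [this]
    rw [Finset.sum_comm]
    refine Finset.sum_congr rfl fun S _ => ?_
    rw [← Finset.mul_sum, ← Finset.sum_div]
    change _ * fourierCoeff G S = _
    ring
  simp only [noiseMean, h, mean_sum, mean_const_mul]
  refine Finset.sum_congr rfl fun S _ => ?_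
  change _ * fourierCoeff F S = _
  ring

lemma fourierCoeff_empty (f : Cube n → ℝ) : fourierCoeff f ∅ = mean f := by
  simp [fourierCoeff]

lemma fourierCoeff_one (S : Finset (Fin n)) :
    fourierCoeff (fun _ => 1) S = if S = ∅ then 1 else 0 := by
  rw [← mean_walsh_mul_walsh]
  simp [fourierCoeff, walsh]

lemma noiseStability_eq (ρ : ℝ) (f : Cube n → ℝ) :
    noiseStability ρ f
      = ∑ S ∈ Finset.univ.erase ∅, ρ ^ S.card * fourierCoeff f S ^ 2 := by
  have h1 : noiseMean ρ (fun x _ : Cube n => f x) = mean f := by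
    have := noiseMean_mul ρ f (fun _ => 1)
    simp only [mul_one, fourierCoeff_one] at this
    rw [this]
    simp [fourierCoeff_empty]
  have h2 : noiseMean ρ (fun _ y : Cube n => f y) = mean f := by
    have := noiseMean_mul ρ (fun _ => 1) f
    simp only [one_mul, fourierCoeff_one] at this
    rw [this]
    simp [fourierCoeff_empty]
  rw [noiseStability, noiseMean_mul, h1, h2,
    ← Finset.add_sum_erase _ _ (Finset.mem_univ (∅ : Finset (Fin n)))]
  simp [fourierCoeff_empty, sq]

/-- Parseval's identity, which is the noise formula at correlation `1`. -/
lemma sum_fourierCoeff_sq (f : Cube n → ℝ) :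
    ∑ S, fourierCoeff f S ^ 2 = mean (fun x => f x ^ 2) := by
  have h := noiseMean_mul 1 f f
  simp only [one_pow, one_mul] at h
  simp only [sq]
  rw [← h, noiseMean]
  congr 1
  funext x
  have hk : ∀ y : Cube n, noiseKernel 1 x y = if y = x then 1 else 0 := by
    intro y
    simp only [noiseKernel, one_mul, sub_self, zero_mul, add_zero]
    split_ifs with hxy
    · subst hxy; simp
    · obtain ⟨i, hi⟩ := Function.ne_iff.1 hxy
      exact Finset.prod_eq_zero (Finset.mem_univ i) (if_neg hi)
  simp [hk]

lemma fourierWeight_one (f : Cube n → ℝ) :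
    fourierWeight 1 f = ∑ i, fourierCoeff f {i} ^ 2 := by
  simp [fourierWeight, Finset.powersetCard_one]

/-! ### Inequalities for powers of sums -/

lemma choose_two_mul_le (k j : ℕ) :
    (2 * k).choose (2 * j) ≤ (2 * k - 1) ^ j * k.choose j := by
  induction j with
  | zero => simp
  | succ j ih =>
    have e1 := Nat.choose_succ_right_eq (2 * k) (2 * j + 1)
    have e2 := Nat.choose_succ_right_eq (2 * k) (2 * j)
    have e3 := Nat.choose_succ_right_eq k j
    have h1 : 2 * k - 2 * j = 2 * (k - j) := by omega
    rw [h1] at e2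
    have h2 : 2 * k - (2 * j + 1) ≤ 2 * k - 1 := by omega
    refine Nat.le_of_mul_le_mul_right (c := (2 * j + 2) * (2 * j + 1)) ?_ (by positivity)
    calc (2 * k).choose (2 * (j + 1)) * ((2 * j + 2) * (2 * j + 1))
        = ((2 * k).choose (2 * j + 1 + 1) * (2 * j + 1 + 1)) * (2 * j + 1) := by ring_nf
      _ = ((2 * k).choose (2 * j + 1) * (2 * j + 1)) * (2 * k - (2 * j + 1)) := by rw [e1]; ring
      _ = (2 * k).choose (2 * j) * (2 * (k - j)) * (2 * k - (2 * j + 1)) := by rw [e2]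
      _ ≤ ((2 * k - 1) ^ j * k.choose j) * (2 * (k - j)) * (2 * k - 1) := by gcongr
      _ = (2 * k - 1) ^ (j + 1) * 2 * (k.choose j * (k - j)) := by ring
      _ = (2 * k - 1) ^ (j + 1) * k.choose (j + 1) * (2 * (j + 1)) * 1 := by rw [← e3]; ring
      _ ≤ (2 * k - 1) ^ (j + 1) * k.choose (j + 1) * (2 * (j + 1)) * (2 * j + 1) := by
        gcongr; omega
      _ = _ := by ring

lemma sum_range_two_mul_add_one (F : ℕ → ℝ) (k : ℕ) :
    ∑ m ∈ Finset.range (2 * k + 1), F m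
      = ∑ j ∈ Finset.range (k + 1), F (2 * j) + ∑ j ∈ Finset.range k, F (2 * j + 1) := by
  induction k with
  | zero => simp
  | succ k ih =>
    rw [show 2 * (k + 1) + 1 = 2 * k + 1 + 1 + 1 by ring, Finset.sum_range_succ,
      Finset.sum_range_succ, ih, Finset.sum_range_succ (fun j => F (2 * j)) (k + 1),
      Finset.sum_range_succ (fun j => F (2 * j + 1)) k]
    ring_nf

/-- The two-point hypercontractive inequality for an even exponent: after binomial expansion it
holds term by term. -/
lemma two_point_pow_le (k : ℕ) (a b : ℝ) :
    (a + b) ^ (2 * k) + (a - b) ^ (2 * k)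
      ≤ 2 * (a ^ 2 + ((2 * k - 1 : ℕ) : ℝ) * b ^ 2) ^ k := by
  have h : (a + b) ^ (2 * k) + (a - b) ^ (2 * k)
      = 2 * ∑ j ∈ Finset.range (k + 1),
          (b ^ 2) ^ j * (a ^ 2) ^ (k - j) * ((2 * k).choose (2 * j) : ℝ) := by
    rw [add_comm a b, sub_eq_neg_add, add_pow, add_pow, ← Finset.sum_add_distrib,
      sum_range_two_mul_add_one, Finset.mul_sum]
    rw [Finset.sum_eq_zero (s := Finset.range k), add_zero]
    · refine Finset.sum_congr rfl fun j hj => ?_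
      have hj' : j ≤ k := Nat.lt_succ_iff.1 (Finset.mem_range.1 hj)
      rw [Even.neg_pow (even_two_mul j), ← Nat.mul_sub, pow_mul, pow_mul]
      ring
    · intro j _
      rw [Odd.neg_pow (odd_two_mul_add_one j)]
      ring
  rw [h, add_comm (a ^ 2), add_pow]
  refine mul_le_mul_of_nonneg_left (Finset.sum_le_sum fun j _ => ?_) zero_le_two
  rw [mul_pow]
  have hc : ((2 * k).choose (2 * j) : ℝ) ≤ ((2 * k - 1 : ℕ) : ℝ) ^ j * (k.choose j : ℝ) := by
    exact_mod_cast choose_two_mul_le k j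
  calc (b ^ 2) ^ j * (a ^ 2) ^ (k - j) * ((2 * k).choose (2 * j) : ℝ)
      ≤ (b ^ 2) ^ j * (a ^ 2) ^ (k - j) * (((2 * k - 1 : ℕ) : ℝ) ^ j * (k.choose j : ℝ)) := by
        gcongr
    _ = _ := by ring

/-- Minkowski's inequality for nonnegative functions on the cube, without roots. -/
lemma mean_add_pow_le {k : ℕ} (hk : 1 ≤ k) {A B : Cube n → ℝ} (hA : ∀ x, 0 ≤ A x)
    (hB : ∀ x, 0 ≤ B x) {α β : ℝ} (hα : 0 ≤ α) (hβ : 0 ≤ β)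
    (h1 : mean (fun x => A x ^ k) ≤ α ^ k) (h2 : mean (fun x => B x ^ k) ≤ β ^ k) :
    mean (fun x => (A x + B x) ^ k) ≤ (α + β) ^ k := by
  have hk0 : k ≠ 0 := by omega
  have hkr : (1 : ℝ) ≤ k := by exact_mod_cast hk
  have root : ∀ {F : Cube n → ℝ}, (∀ x, 0 ≤ F x) → 0 ≤ mean (fun x => F x ^ k) := fun hF =>
    mean_nonneg fun x => pow_nonneg (hF x) k
  have main : mean (fun x => (A x + B x) ^ k) ^ (1 / (k : ℝ))
      ≤ mean (fun x => A x ^ k) ^ (1 / (k : ℝ)) + mean (fun x => B x ^ k) ^ (1 / (k : ℝ)) := by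
    have := Real.Lp_add_le_of_nonneg (s := Finset.univ) (f := A) (g := B) hkr
      (fun x _ => hA x) (fun x _ => hB x)
    simp only [Real.rpow_natCast] at this
    unfold mean
    rw [Real.div_rpow, Real.div_rpow, Real.div_rpow, ← add_div]
    · gcongr
    all_goals first
      | positivity
      | exact Finset.sum_nonneg fun x _ => pow_nonneg (hA x) k
      | exact Finset.sum_nonneg fun x _ => pow_nonneg (hB x) k
      | exact Finset.sum_nonneg fun x _ => pow_nonneg (add_nonneg (hA x) (hB x)) k
  have r : ∀ {u v : ℝ}, 0 ≤ u → 0 ≤ v → u ≤ v ^ k → u ^ (1 / (k : ℝ)) ≤ v := by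
    intro u v hu hv huv
    have := Real.rpow_le_rpow hu huv (by positivity : (0 : ℝ) ≤ 1 / k)
    rwa [one_div, Real.pow_rpow_inv_natCast hv hk0, ← one_div] at this
  have h3 : mean (fun x => (A x + B x) ^ k) ^ (1 / (k : ℝ)) ≤ α + β :=
    main.trans (add_le_add (r (root hA) hα h1) (r (root hB) hβ h2))
  have h0 := root fun x => add_nonneg (hA x) (hB x)
  calc mean (fun x => (A x + B x) ^ k)
      = (mean (fun x => (A x + B x) ^ k) ^ (1 / (k : ℝ))) ^ k := by
        rw [one_div, Real.rpow_inv_natCast_pow h0 hk0]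
    _ ≤ (α + β) ^ k := by gcongr

/-- Jensen's inequality for a power, with weights that are not normalised. -/
lemma sum_mul_pow_le {ι : Type*} (s : Finset ι) {w f : ι → ℝ} (hw : ∀ i ∈ s, 0 ≤ w i)
    (hf : ∀ i ∈ s, 0 ≤ f i) (m : ℕ) :
    (∑ i ∈ s, w i * f i) ^ (m + 1)
      ≤ (∑ i ∈ s, w i) ^ m * ∑ i ∈ s, w i * f i ^ (m + 1) := by
  have h0 : 0 ≤ ∑ i ∈ s, w i := Finset.sum_nonneg hw
  rcases h0.eq_or_lt with h | h
  · have hz := (Finset.sum_eq_zero_iff_of_nonneg hw).1 h.symm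
    have : ∑ i ∈ s, w i * f i = 0 := Finset.sum_eq_zero fun i hi => by rw [hz i hi, zero_mul]
    rw [this, zero_pow (Nat.succ_ne_zero m)]
    exact mul_nonneg (pow_nonneg h0 m) (Finset.sum_nonneg fun i hi =>
      mul_nonneg (hw i hi) (pow_nonneg (hf i hi) _))
  · have := Real.pow_arith_mean_le_arith_mean_pow s (fun i => w i / ∑ j ∈ s, w j) f
      (fun i hi => div_nonneg (hw i hi) h0) (by rw [← Finset.sum_div, div_self h.ne']) hf (m + 1)
    simp only [div_mul_eq_mul_div, ← Finset.sum_div] at this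
    rw [div_pow, div_le_div_iff₀ (pow_pos h _) h] at this
    refine le_of_mul_le_mul_right (this.trans_eq ?_) h
    ring

/-- Hölder's inequality for sums, without roots. -/
lemma sum_pow_le_of_pow_le {ι : Type*} (s : Finset ι) {N A V : ι → ℝ} (hN : ∀ i ∈ s, 0 ≤ N i)
    (hA : ∀ i ∈ s, 0 ≤ A i) (hV : ∀ i ∈ s, 0 ≤ V i) {m : ℕ} (hm : m ≠ 0)
    (h : ∀ i ∈ s, N i ^ (m + 1) ≤ A i ^ m * V i) :
    (∑ i ∈ s, N i) ^ (m + 1) ≤ (∑ i ∈ s, A i) ^ m * ∑ i ∈ s, V i := by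
  have e : ∀ i ∈ s, N i = A i * (N i / A i) := by
    intro i hi
    rcases (hA i hi).eq_or_lt with h0 | h0
    · have := h i hi
      rw [← h0, zero_pow hm, zero_mul] at this
      rw [← h0, zero_mul]
      exact eq_zero_of_pow_eq_zero (this.antisymm (pow_nonneg (hN i hi) _))
    · field_simp
  rw [Finset.sum_congr rfl e]
  refine (sum_mul_pow_le s hA (fun i hi => div_nonneg (hN i hi) (hA i hi)) m).trans ?_
  have hs : 0 ≤ (∑ i ∈ s, A i) ^ m := pow_nonneg (Finset.sum_nonneg hA) m
  refine mul_le_mul_of_nonneg_left (Finset.sum_le_sum fun i hi => ?_) hs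
  rcases (hA i hi).eq_or_lt with h0 | h0
  · rw [← h0, zero_mul]; exact hV i hi
  · rw [div_pow, mul_div_assoc', div_le_iff₀ (pow_pos h0 _)]
    calc A i * N i ^ (m + 1) ≤ A i * (A i ^ m * V i) := by gcongr; exact h i hi
      _ = _ := by ring

lemma mean_mul_pow_le {g h : Cube n → ℝ} (hg : ∀ x, 0 ≤ g x) (hh : ∀ x, 0 ≤ h x) (m : ℕ) :
    mean (fun x => g x * h x) ^ (m + 1)
      ≤ mean g ^ m * mean (fun x => g x * h x ^ (m + 1)) := by
  have := sum_mul_pow_le Finset.univ (fun x _ => hg x) (fun x _ => hh x) m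
  unfold mean
  rw [div_pow, div_pow, div_mul_div_comm, ← pow_succ]
  gcongr

lemma mean_mul_sq_le (g h : Cube n → ℝ) :
    mean (fun x => g x * h x) ^ 2 ≤ mean (fun x => g x ^ 2) * mean (fun x => h x ^ 2) := by
  have := Finset.sum_mul_sq_le_sq_mul_sq Finset.univ g h
  unfold mean
  rw [div_pow, div_mul_div_comm, ← sq]
  gcongr

/-! ### Hypercontractivity -/

/-- The Bonami lemma: the noise operator `walsh S ↦ τ ^ #S * walsh S` is a contraction from `L²` to
`L^{2k}` if `τ² (2k - 1) ≤ 1`. By induction on the set of coordinates: averaging over the sign of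
one coordinate uses the two-point inequality, and Minkowski's inequality in `L^k` combines the two
halves of the polynomial. -/
lemma mean_noise_pow_le {k : ℕ} (hk : 1 ≤ k) {τ : ℝ} (hτ : τ ^ 2 * ((2 * k - 1 : ℕ) : ℝ) ≤ 1)
    (U : Finset (Fin n)) (a : Finset (Fin n) → ℝ) :
    mean (fun x : Cube n => (∑ S ∈ U.powerset, τ ^ S.card * a S * walsh S x) ^ (2 * k))
      ≤ (∑ S ∈ U.powerset, a S ^ 2) ^ k := by
  induction U using Finset.induction_on generalizing a with
  | empty => simp [walsh, mean_const, pow_mul]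
  | insert i U hi ih =>
    set A : Cube n → ℝ := fun x => ∑ S ∈ U.powerset, τ ^ S.card * a S * walsh S x with hA
    set B : Cube n → ℝ := fun x => ∑ S ∈ U.powerset, τ ^ S.card * a (insert i S) * walsh S x
      with hB
    have hmem : ∀ S ∈ U.powerset, i ∉ S := fun S hS hiS => hi (Finset.mem_powerset.1 hS hiS)
    have split : ∀ x : Cube n,
        ∑ S ∈ (insert i U).powerset, τ ^ S.card * a S * walsh S x
          = A x + coord x i * (τ * B x) := by
      intro x
      rw [Finset.sum_powerset_insert hi, hA, hB]
      simp only [Finset.mul_sum]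
      congr 1
      refine Finset.sum_congr rfl fun S hS => ?_
      rw [Finset.card_insert_of_notMem (hmem S hS), walsh_insert (hmem S hS)]
      ring
    have fA : ∀ x, A (flip i x) = A x := fun x => Finset.sum_congr rfl fun S hS => by
      rw [walsh_flip_of_notMem (hmem S hS)]
    have fB : ∀ x, B (flip i x) = B x := fun x => Finset.sum_congr rfl fun S hS => by
      rw [walsh_flip_of_notMem (hmem S hS)]
    simp only [split]
    rw [Finset.sum_powerset_insert hi]
    have pt : ∀ x, (A x + coord x i * (τ * B x)) ^ (2 * k)
        + (A x + coord (flip i x) i * (τ * B x)) ^ (2 * k)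
          ≤ 2 * (A x ^ 2 + B x ^ 2) ^ k := by
      intro x
      have h2 := two_point_pow_le k (A x) (τ * B x)
      have h3 : A x ^ 2 + ((2 * k - 1 : ℕ) : ℝ) * (τ * B x) ^ 2 ≤ A x ^ 2 + B x ^ 2 := by
        have := mul_le_mul_of_nonneg_right hτ (sq_nonneg (B x))
        linarith
      have h4 : (A x + τ * B x) ^ (2 * k) + (A x - τ * B x) ^ (2 * k)
          ≤ 2 * (A x ^ 2 + B x ^ 2) ^ k := h2.trans (by gcongr)
      rw [coord_flip_self]
      rcases coord_eq x i with ⟨-, h⟩ | ⟨-, h⟩ <;> rw [h]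
      · simpa [sub_eq_add_neg] using h4
      · rw [add_comm]; simpa [sub_eq_add_neg] using h4
    have m1 := mean_mono pt
    rw [mean_add, mean_const_mul] at m1
    have m2 := mean_flip i fun x => (A x + coord x i * (τ * B x)) ^ (2 * k)
    simp only [fA, fB] at m2
    rw [m2] at m1
    have m3 : mean (fun x => (A x + coord x i * (τ * B x)) ^ (2 * k))
        ≤ mean (fun x => (A x ^ 2 + B x ^ 2) ^ k) := by linarith
    refine m3.trans (mean_add_pow_le hk (fun x => sq_nonneg _) (fun x => sq_nonneg _)
      (Finset.sum_nonneg fun S _ => sq_nonneg _) (Finset.sum_nonneg fun S _ => sq_nonneg _) ?_ ?_)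
    · simpa only [← pow_mul] using ih a
    · simpa only [← pow_mul] using ih fun S => a (insert i S)

/-- For a nonnegative Walsh polynomial `g` with coefficients `b`, hypercontractivity bounds the
norm of its noisy version in terms of `E g = b ∅` and `E g² = ∑ b²`. -/
lemma sum_pow_card_mul_sq_pow_le (J : Finset (Fin n)) (b : Finset (Fin n) → ℝ)
    (hb : ∀ x : Cube n, 0 ≤ ∑ T ∈ J.powerset, b T * walsh T x) {σ : ℝ} (hσ : 0 ≤ σ) (m : ℕ)
    (hm : σ * (2 * m + 1) ≤ 1) :
    (∑ T ∈ J.powerset, σ ^ T.card * b T ^ 2) ^ (m + 1)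
      ≤ (b ∅ ^ 2) ^ m * ∑ T ∈ J.powerset, b T ^ 2 := by
  set τ := Real.sqrt σ with hτ
  have hτ2 : τ ^ 2 = σ := Real.sq_sqrt hσ
  set N := ∑ T ∈ J.powerset, σ ^ T.card * b T ^ 2 with hN
  set V := ∑ T ∈ J.powerset, b T ^ 2 with hV
  have hN0 : 0 ≤ N := Finset.sum_nonneg fun T _ => by positivity
  have hV0 : 0 ≤ V := Finset.sum_nonneg fun T _ => by positivity
  set g : Cube n → ℝ := fun x => ∑ T ∈ J.powerset, b T * walsh T x with hg
  set h : Cube n → ℝ := fun x => ∑ T ∈ J.powerset, τ ^ T.card * (τ ^ T.card * b T) * walsh T x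
    with hh
  have e : ∀ T : Finset (Fin n), σ ^ T.card = τ ^ T.card * τ ^ T.card := fun T => by
    rw [← hτ2, ← pow_mul, mul_comm, pow_mul, sq]
  have hgh : mean (fun x => g x * h x) = N := by
    rw [hg, hh, mean_walshSum_mul_walshSum]
    exact Finset.sum_congr rfl fun T _ => by rw [e]; ring
  have hgg : mean (fun x => g x ^ 2) = V := by
    simp only [sq, hg]
    rw [mean_walshSum_mul_walshSum, hV]
    simp only [sq]
  have hg1 : mean g = b ∅ := mean_walshSum _ (Finset.empty_mem_powerset J) b
  have hb0 : 0 ≤ b ∅ := hg1 ▸ mean_nonneg hb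
  have hhyp : mean (fun x => h x ^ (2 * (m + 1))) ≤ N ^ (m + 1) := by
    have := mean_noise_pow_le (n := n) (k := m + 1) (τ := τ) (by omega) (by
      rw [hτ2, show 2 * (m + 1) - 1 = 2 * m + 1 by omega]
      push_cast
      exact hm) J (fun T => τ ^ T.card * b T)
    refine this.trans_eq ?_
    congr 1
    exact Finset.sum_congr rfl fun T _ => by rw [e]; ring
  have h1 : N ≤ mean (fun x => g x * |h x|) := by
    rw [← hgh]
    exact mean_mono fun x => mul_le_mul_of_nonneg_left (le_abs_self _) (hb x)
  have h2 := mean_mul_pow_le (g := g) (h := fun x => |h x|) hb (fun x => abs_nonneg _) m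
  have h3 := mean_mul_sq_le g (fun x => |h x| ^ (m + 1))
  have h4 : ∀ x, (|h x| ^ (m + 1)) ^ 2 = h x ^ (2 * (m + 1)) := fun x => by
    rw [← pow_mul, mul_comm, pow_mul, sq_abs, pow_mul]
  simp only [h4] at h3
  rw [hgg] at h3
  rw [hg1] at h2
  have h5 : N ^ (m + 1) ≤ b ∅ ^ m * mean (fun x => g x * |h x| ^ (m + 1)) :=
    (pow_le_pow_left₀ hN0 h1 _).trans h2
  have h6 : N ^ (m + 1) * N ^ (m + 1) ≤ (b ∅ ^ 2) ^ m * V * N ^ (m + 1) :=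
    calc N ^ (m + 1) * N ^ (m + 1) = (N ^ (m + 1)) ^ 2 := (sq _).symm
      _ ≤ (b ∅ ^ m * mean (fun x => g x * |h x| ^ (m + 1))) ^ 2 :=
        pow_le_pow_left₀ (pow_nonneg hN0 _) h5 2
      _ = (b ∅ ^ 2) ^ m * mean (fun x => g x * |h x| ^ (m + 1)) ^ 2 := by ring
      _ ≤ (b ∅ ^ 2) ^ m * (V * N ^ (m + 1)) := by
        gcongr
        exact h3.trans (mul_le_mul_of_nonneg_left hhyp hV0)
      _ = _ := by ring
  rcases (pow_nonneg hN0 (m + 1)).eq_or_lt with h0 | h0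
  · rw [← h0]; positivity
  · exact le_of_mul_le_mul_right h6 h0

/-! ### Decoupling -/

/-- For `i ∈ I`, the function `y ↦ E[f(x_I, y_{Iᶜ}) x_i]` is nonnegative if `f` is monotone. -/
lemma sum_fourierCoeff_insert_nonneg {f : Cube n → ℝ} (hf : Monotone f) {I : Finset (Fin n)}
    {i : Fin n} (hi : i ∈ I) (y : Cube n) :
    0 ≤ ∑ T ∈ Iᶜ.powerset, fourierCoeff f (insert i T) * walsh T y := by
  have hmem : ∀ T ∈ Iᶜ.powerset, i ∉ T := fun T hT hiT =>
    Finset.mem_compl.1 (Finset.mem_powerset.1 hT hiT) hi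
  set w : Cube n → ℝ := fun x => ∏ j ∈ Iᶜ, (1 + coord x j * coord y j) with hw
  have e : ∑ T ∈ Iᶜ.powerset, fourierCoeff f (insert i T) * walsh T y
      = mean (fun x => w x * (coord x i * f x)) := by
    have : ∀ x : Cube n, w x * (coord x i * f x)
        = ∑ T ∈ Iᶜ.powerset, (f x * walsh (insert i T) x) * walsh T y := by
      intro x
      simp only [hw]
      rw [Finset.prod_one_add, Finset.sum_mul]
      refine Finset.sum_congr rfl fun T hT => ?_
      rw [walsh_insert (hmem T hT), Finset.prod_mul_distrib]
      simp only [walsh]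
      ring
    simp only [this, mean_sum, mean_mul_const]
    rfl
  rw [e]
  have hw0 : ∀ x, 0 ≤ w x := fun x => Finset.prod_nonneg fun j _ => by
    rcases coord_eq x j with ⟨-, h⟩ | ⟨-, h⟩ <;>
      rcases coord_eq y j with ⟨-, h'⟩ | ⟨-, h'⟩ <;> rw [h, h'] <;> norm_num
  have hwf : ∀ x, w (flip i x) = w x := fun x => Finset.prod_congr rfl fun j hj => by
    rw [coord_flip_of_ne x (by rintro rfl; exact Finset.mem_compl.1 hj hi)]
  have m1 := mean_flip i fun x => w x * (coord x i * f x)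
  simp only [hwf, coord_flip_self] at m1
  have m2 : 0 ≤ mean (fun x => w x * (coord x i * f x)
      + w x * (-coord x i * f (flip i x))) := by
    refine mean_nonneg fun x => ?_
    have hle : 0 ≤ coord x i * (f x - f (flip i x)) := by
      rcases coord_eq x i with ⟨h, h'⟩ | ⟨h, h'⟩
      · have : flip i x ≤ x := by
          rw [flip, update_le_self_iff, h]; decide
        have := hf this
        rw [h']; linarith
      · have : x ≤ flip i x := by
          rw [flip, le_update_self_iff, h]; decide
        have := hf this
        rw [h']; linarith
    nlinarith [mul_nonneg (hw0 x) hle]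
  rw [mean_add, m1] at m2
  linarith

/-- The mixed Fourier weight of `f` on the sets that meet `I` exactly in `i`, where each coordinate
outside `I` is damped by `σ`. -/
noncomputable def splitWeight (f : Cube n → ℝ) (σ : ℝ) (I : Finset (Fin n)) (i : Fin n) : ℝ :=
  ∑ T ∈ Iᶜ.powerset, σ ^ T.card * fourierCoeff f (insert i T) ^ 2

lemma sum_splitWeight_pow_le {f : Cube n → ℝ} (hf : Monotone f) {σ : ℝ} (hσ : 0 ≤ σ) {m : ℕ}
    (hm0 : m ≠ 0) (hm : σ * (2 * m + 1) ≤ 1) (I : Finset (Fin n)) :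
    (∑ i ∈ I, splitWeight f σ I i) ^ (m + 1)
      ≤ fourierWeight 1 f ^ m * mean (fun x => f x ^ 2) := by
  have h := sum_pow_le_of_pow_le I (N := splitWeight f σ I) (A := fun i => fourierCoeff f {i} ^ 2)
    (V := fun i => ∑ T ∈ Iᶜ.powerset, fourierCoeff f (insert i T) ^ 2)
    (fun i _ => Finset.sum_nonneg fun T _ => by positivity) (fun i _ => sq_nonneg _)
    (fun i _ => Finset.sum_nonneg fun T _ => sq_nonneg _) hm0
    (fun i hi => by
      simpa [splitWeight] using sum_pow_card_mul_sq_pow_le Iᶜ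
        (fun T => fourierCoeff f (insert i T)) (sum_fourierCoeff_insert_nonneg hf hi) hσ m hm)
  refine h.trans ?_
  have hA : ∑ i ∈ I, fourierCoeff f {i} ^ 2 ≤ fourierWeight 1 f := by
    rw [fourierWeight_one]
    exact Finset.sum_le_univ_sum_of_nonneg fun i => sq_nonneg _
  have hV : ∑ i ∈ I, ∑ T ∈ Iᶜ.powerset, fourierCoeff f (insert i T) ^ 2
      ≤ mean (fun x => f x ^ 2) := by
    rw [← sum_fourierCoeff_sq, ← Finset.sum_product',
      ← Finset.sum_image (f := fun S => fourierCoeff f S ^ 2) (s := I ×ˢ Iᶜ.powerset)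
        (g := fun p => insert p.1 p.2)]
    · exact Finset.sum_le_univ_sum_of_nonneg fun S => sq_nonneg _
    · -- `i` and `T` are the traces of `insert i T` on `I` and on its complement
      rintro ⟨i, T⟩ hp ⟨j, R⟩ hq hpq
      simp only [Finset.coe_product, Set.mem_prod, Finset.mem_coe, Finset.mem_powerset] at hp hq
      have trace : ∀ {i : Fin n} {T : Finset (Fin n)}, i ∈ I → T ⊆ Iᶜ →
          insert i T ∩ I = {i} ∧ insert i T ∩ Iᶜ = T := by
        intro i T hi hT
        constructor
        · rw [Finset.insert_inter_of_mem hi, Finset.disjoint_iff_inter_eq_empty.1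
            (Finset.subset_compl_iff_disjoint_right.1 hT), insert_empty_eq]
        · rw [Finset.insert_inter_of_notMem (by simpa using hi), Finset.inter_eq_left.2 hT]
      have t1 := trace hp.1 hp.2
      have t2 := trace hq.1 hq.2
      change insert i T = insert j R at hpq
      rw [hpq] at t1
      have hij : i = j := Finset.singleton_injective (t1.1.symm.trans t2.1)
      have hTR : T = R := t1.2.symm.trans t2.2
      rw [hij, hTR]
  have hA0 : 0 ≤ ∑ i ∈ I, fourierCoeff f {i} ^ 2 := Finset.sum_nonneg fun i _ => sq_nonneg _
  exact mul_le_mul (pow_le_pow_left₀ hA0 hA m) hV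
    (Finset.sum_nonneg fun i _ => Finset.sum_nonneg fun T _ => sq_nonneg _)
    (pow_nonneg (hA0.trans hA) m)

lemma card_filter_split {i : Fin n} {T : Finset (Fin n)} (h : i ∉ T) :
    (((Finset.univ.filter fun I : Finset (Fin n) => i ∈ I ∧ T ⊆ Iᶜ).card : ℕ) : ℝ)
      * 2 ^ (T.card + 1) = 2 ^ n := by
  have e : (Finset.univ.filter fun I : Finset (Fin n) => i ∈ I ∧ T ⊆ Iᶜ)
      = Finset.Icc {i} Tᶜ := by
    ext I
    simp only [Finset.mem_filter, Finset.mem_univ, true_and, Finset.mem_Icc,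
      Finset.singleton_subset_iff]
    rw [Finset.subset_compl_comm]
  have hle : T.card + 1 ≤ n := by
    rw [← Finset.card_insert_of_notMem h]
    simpa using Finset.card_le_univ (insert i T)
  rw [e, Finset.card_Icc_finset (by simpa using h), Finset.card_compl, Finset.card_singleton,
    Fintype.card_fin]
  push_cast
  rw [← pow_add]
  congr 1
  omega

/-- Averaging over a uniformly random `I`: a nonempty set `S` meets `I` in exactly one point with
probability `#S / 2 ^ #S`, which compensates replacing `ρ` by `2 ρ`. -/
lemma noiseStability_le_sum_splitWeight (f : Cube n → ℝ) {ρ : ℝ} (hρ : 0 ≤ ρ) :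
    2 ^ n * noiseStability ρ f ≤ 2 * ρ * ∑ I, ∑ i ∈ I, splitWeight f (2 * ρ) I i := by
  have h1 : ∑ I, ∑ i ∈ I, splitWeight f (2 * ρ) I i
      = ∑ i, ∑ T ∈ Finset.univ.filter fun T : Finset (Fin n) => i ∉ T,
        (((Finset.univ.filter fun I : Finset (Fin n) => i ∈ I ∧ T ⊆ Iᶜ).card : ℕ) : ℝ)
          * ((2 * ρ) ^ T.card * fourierCoeff f (insert i T) ^ 2) := by
    have : ∀ I : Finset (Fin n), ∑ i ∈ I, splitWeight f (2 * ρ) I i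
        = ∑ i, ∑ T ∈ Finset.univ.filter fun T : Finset (Fin n) => i ∉ T,
          if i ∈ I ∧ T ⊆ Iᶜ then (2 * ρ) ^ T.card * fourierCoeff f (insert i T) ^ 2 else 0 := by
      intro I
      rw [← Finset.sum_subset (Finset.subset_univ I)]
      · refine Finset.sum_congr rfl fun i hi => ?_
        rw [splitWeight, ← Finset.sum_filter, Finset.filter_filter]
        refine Finset.sum_congr ?_ fun _ _ => rfl
        ext T
        simp only [Finset.mem_powerset, Finset.mem_filter, Finset.mem_univ, true_and, hi]
        exact ⟨fun h => ⟨fun hiT => Finset.mem_compl.1 (h hiT) hi, h⟩, fun h => h.2⟩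
      · intro i _ hi
        simp [hi]
    simp only [this]
    rw [Finset.sum_comm]
    refine Finset.sum_congr rfl fun i _ => ?_
    rw [Finset.sum_comm]
    refine Finset.sum_congr rfl fun T _ => ?_
    rw [← Finset.sum_filter, Finset.sum_const, nsmul_eq_mul]
  have h2 : 2 * ρ * ∑ I, ∑ i ∈ I, splitWeight f (2 * ρ) I i
      = 2 ^ n * ∑ i, ∑ T ∈ Finset.univ.filter fun T : Finset (Fin n) => i ∉ T,
        ρ ^ (insert i T).card * fourierCoeff f (insert i T) ^ 2 := by
    rw [h1, Finset.mul_sum, Finset.mul_sum]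
    refine Finset.sum_congr rfl fun i _ => ?_
    rw [Finset.mul_sum, Finset.mul_sum]
    refine Finset.sum_congr rfl fun T hT => ?_
    have hiT : i ∉ T := (Finset.mem_filter.1 hT).2
    rw [← card_filter_split hiT, Finset.card_insert_of_notMem hiT, mul_pow]
    ring
  rw [h2]
  refine mul_le_mul_of_nonneg_left ?_ (by positivity)
  have h3 : ∀ i : Fin n, ∑ T ∈ Finset.univ.filter fun T : Finset (Fin n) => i ∉ T,
        ρ ^ (insert i T).card * fourierCoeff f (insert i T) ^ 2
      = ∑ S ∈ Finset.univ.filter fun S : Finset (Fin n) => i ∈ S,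
        ρ ^ S.card * fourierCoeff f S ^ 2 := by
    intro i
    refine Finset.sum_bij' (fun T _ => insert i T) (fun S _ => S.erase i) ?_ ?_ ?_ ?_ ?_
    · intro T _; simp
    · intro S _; simp
    · intro T hT; exact Finset.erase_insert (Finset.mem_filter.1 hT).2
    · intro S hS; exact Finset.insert_erase (Finset.mem_filter.1 hS).2
    · intro T _; rfl
  simp only [h3, Finset.sum_filter]
  rw [Finset.sum_comm, noiseStability_eq]
  refine (Finset.sum_le_sum fun S hS => ?_).trans
    (Finset.sum_le_univ_sum_of_nonneg fun S => Finset.sum_nonneg fun i _ => ?_)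
  · obtain ⟨i, hi⟩ := Finset.nonempty_iff_ne_empty.2 (Finset.ne_of_mem_erase hS)
    have := Finset.single_le_sum (f := fun i => if i ∈ S then ρ ^ S.card * fourierCoeff f S ^ 2
      else 0) (s := Finset.univ) (fun j _ => by split_ifs <;> positivity)
      (Finset.mem_univ i)
    simpa [hi] using this
  · split_ifs <;> positivity

/-- If the noise stability of a monotone `f` is large then so is its first-degree weight, for
every exponent `m + 1` at which the noise is hypercontractive. -/
lemma noiseStability_pow_le {f : Cube n → ℝ} (hf : Monotone f) {ρ : ℝ} (hρ : 0 ≤ ρ) {m : ℕ}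
    (hm0 : m ≠ 0) (hm : 2 * ρ * (2 * m + 1) ≤ 1) (hs : 0 ≤ noiseStability ρ f) :
    noiseStability ρ f ^ (m + 1)
      ≤ (2 * ρ) ^ (m + 1) * (fourierWeight 1 f ^ m * mean (fun x => f x ^ 2)) := by
  obtain ⟨I, hI⟩ : ∃ I : Finset (Fin n),
      noiseStability ρ f ≤ 2 * ρ * ∑ i ∈ I, splitWeight f (2 * ρ) I i := by
    have h := noiseStability_le_sum_splitWeight f hρ
    have hc : ∑ _I : Finset (Fin n), noiseStability ρ f = 2 ^ n * noiseStability ρ f := by simp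
    rw [← hc, Finset.mul_sum] at h
    obtain ⟨I, -, hI⟩ := Finset.exists_le_of_sum_le Finset.univ_nonempty h
    exact ⟨I, hI⟩
  calc noiseStability ρ f ^ (m + 1)
      ≤ (2 * ρ * ∑ i ∈ I, splitWeight f (2 * ρ) I i) ^ (m + 1) := pow_le_pow_left₀ hs hI _
    _ = (2 * ρ) ^ (m + 1) * (∑ i ∈ I, splitWeight f (2 * ρ) I i) ^ (m + 1) := mul_pow _ _ _
    _ ≤ _ := by
      gcongr
      exact sum_splitWeight_pow_le hf (by positivity) hm0 hm I

/-! ### Correlation with a halfspace -/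

lemma cov_eq_mean_sub_mul (f g : Cube n → ℝ) :
    cov f g = mean (fun x => (f x - mean f) * g x) := by
  simp only [sub_mul, mean_sub, mean_const_mul, cov]

/-- Layer-cake formula for the truncation of `z` to `[-T, T]`. -/
lemma integral_step (z : ℝ) {T : ℝ} (hT : 0 ≤ T) :
    ∫ t in (-T)..T, (if t < z then (1 : ℝ) else 0) = max (-T) (min z T) + T := by
  have e : (fun t : ℝ => if t < z then (1 : ℝ) else 0) = (Set.Iio z).indicator fun _ => 1 := by
    funext t
    simp [Set.indicator_apply]
  rw [intervalIntegral.integral_of_le (by linarith), e,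
    MeasureTheory.setIntegral_indicator measurableSet_Iio, MeasureTheory.setIntegral_const,
    smul_eq_mul, mul_one]
  rcases le_or_gt z T with h | h
  · have : Set.Ioc (-T) T ∩ Set.Iio z = Set.Ioo (-T) z := by
      ext t
      simp only [Set.mem_inter_iff, Set.mem_Ioc, Set.mem_Iio, Set.mem_Ioo]
      exact ⟨fun ht => ⟨ht.1.1, ht.2⟩, fun ht => ⟨⟨ht.1, by linarith [ht.2]⟩, ht.2⟩⟩
    rw [this, Real.volume_real_Ioo, min_eq_left h]
    rcases le_total z (-T) with h' | h'
    · rw [max_eq_left h', max_eq_right (by linarith)]; ring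
    · rw [max_eq_right h', max_eq_left (by linarith)]; ring
  · have : Set.Ioc (-T) T ∩ Set.Iio z = Set.Ioc (-T) T := by
      refine Set.inter_eq_left.2 fun t ht => ?_
      exact lt_of_le_of_lt ht.2 h
    rw [this, Real.volume_real_Ioc, min_eq_right h.le, max_eq_left (by linarith),
      max_eq_right (by linarith)]
    ring

lemma intervalIntegrable_step (z a b : ℝ) :
    IntervalIntegrable (fun t : ℝ => if t < z then (1 : ℝ) else 0) MeasureTheory.volume a b := by
  refine AntitoneOn.intervalIntegrable fun s _ t _ hst => ?_
  split_ifs with h1 h2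
  · exact le_rfl
  · exact absurd (hst.trans_lt h1) h2
  · exact zero_le_one
  · exact le_rfl

/-- If no threshold of `Z` has covariance more than `D` with `f`, then the covariance of `f` and `Z`
is at most `2 T D`, up to the error in truncating `Z` at height `T`. -/
lemma cov_le_of_threshold_le {f : Cube n → ℝ} (hf : ∀ x, |f x - mean f| ≤ 1) (Z : Cube n → ℝ)
    {T D : ℝ} (hT : 0 ≤ T) (hD : ∀ t : ℝ, cov f (fun x => if t < Z x then 1 else 0) ≤ D) :
    cov f Z ≤ 2 * T * D + mean (fun x => |Z x - max (-T) (min (Z x) T)|) := by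
  set φ : Cube n → ℝ := fun x => max (-T) (min (Z x) T) with hφ
  have h1 : mean (fun x => (f x - mean f) * (φ x + T)) ≤ 2 * T * D := by
    have e : mean (fun x => (f x - mean f) * (φ x + T))
        = ∫ t in (-T)..T, cov f (fun x => if t < Z x then 1 else 0) := by
      simp only [cov_eq_mean_sub_mul, mean]
      rw [intervalIntegral.integral_div, intervalIntegral.integral_finsetSum]
      · congr 1
        refine Finset.sum_congr rfl fun x _ => ?_
        rw [intervalIntegral.integral_const_mul, integral_step _ hT]
      · exact fun x _ => (intervalIntegrable_step _ _ _).const_mul _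
    rw [e]
    have hi : IntervalIntegrable (fun t : ℝ => cov f (fun x => if t < Z x then 1 else 0))
        MeasureTheory.volume (-T) T := by
      simp only [cov_eq_mean_sub_mul, mean]
      refine IntervalIntegrable.div_const ?_ _
      have := IntervalIntegrable.sum (μ := MeasureTheory.volume) (a := -T) (b := T) Finset.univ
        (f := fun (x : Cube n) (t : ℝ) => (f x - (∑ y, f y) / 2 ^ n) * (if t < Z x then 1 else 0))
        fun x _ => (intervalIntegrable_step _ _ _).const_mul _
      simpa only [Finset.sum_fn] using this
    calc ∫ t in (-T)..T, cov f (fun x => if t < Z x then 1 else 0)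
        ≤ ∫ _t in (-T)..T, D :=
          intervalIntegral.integral_mono_on (by linarith) hi intervalIntegrable_const
            fun t _ => hD t
      _ = 2 * T * D := by
          rw [intervalIntegral.integral_const, smul_eq_mul]; ring
  have h2 : mean (fun x => (f x - mean f) * (Z x - φ x)) ≤ mean (fun x => |Z x - φ x|) := by
    refine mean_mono fun x => (le_abs_self _).trans ?_
    rw [abs_mul]
    exact mul_le_of_le_one_left (abs_nonneg _) (hf x)
  have h3 : cov f Z = mean (fun x => (f x - mean f) * (φ x + T))
      + mean (fun x => (f x - mean f) * (Z x - φ x)) := by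
    have : ∀ x, (f x - mean f) * Z x = ((f x - mean f) * (φ x + T)
        + (f x - mean f) * (Z x - φ x)) - (f x - mean f) * T := fun x => by ring
    rw [cov_eq_mean_sub_mul]
    simp only [this]
    rw [mean_sub, mean_mul_const, mean_sub, mean_const, sub_self, zero_mul, sub_zero, mean_add]
  rw [h3]
  exact add_le_add h1 h2

lemma abs_sub_truncate_le (z : ℝ) {T : ℝ} (hT : 1 ≤ T) :
    |z - max (-T) (min z T)| ≤ Real.exp (-T ^ 2) * (Real.exp (T * z) + Real.exp (-T * z)) := by
  have key : ∀ u : ℝ, T ≤ u → u - T ≤ Real.exp (-T ^ 2) * Real.exp (T * u) := by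
    intro u hu
    rw [← Real.exp_add]
    have h1 := Real.add_one_le_exp (-T ^ 2 + T * u)
    nlinarith [mul_le_mul_of_nonneg_right hT (sub_nonneg.2 hu)]
  have p1 : 0 ≤ Real.exp (-T ^ 2) * Real.exp (T * z) := by positivity
  have p2 : 0 ≤ Real.exp (-T ^ 2) * Real.exp (-T * z) := by positivity
  rw [mul_add]
  rcases le_total z T with h | h
  · rw [min_eq_left h]
    rcases le_total (-T) z with h' | h'
    · rw [max_eq_right h', sub_self, abs_zero]; linarith
    · rw [max_eq_left h', abs_of_nonpos (by linarith)]
      have := key (-z) (by linarith)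
      rw [mul_neg, ← neg_mul] at this
      linarith
  · rw [min_eq_right h, max_eq_right (by linarith), abs_of_nonneg (by linarith)]
    linarith [key z h]

/-- A linear form with coefficients `a` is subgaussian with variance `∑ a²`. -/
lemma mean_exp_le (a : Fin n → ℝ) (s : ℝ) :
    mean (fun x => Real.exp (s * ∑ i, a i * coord x i))
      ≤ Real.exp (s ^ 2 * (∑ i, a i ^ 2) / 2) := by
  have e : mean (fun x : Cube n => Real.exp (s * ∑ i, a i * coord x i))
      = ∏ i, Real.cosh (s * a i) := by
    have h1 : ∀ x : Cube n, Real.exp (s * ∑ i, a i * coord x i)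
        = ∏ i, Real.exp (s * (a i * (((x i : ℤˣ) : ℤ) : ℝ))) := by
      intro x
      rw [Finset.mul_sum, Real.exp_sum]
      rfl
    simp only [mean, h1]
    rw [← Fintype.piFinset_univ, ← Finset.prod_univ_sum (fun _ => Finset.univ)
      (fun i (u : ℤˣ) => Real.exp (s * (a i * ((u : ℤ) : ℝ))))]
    have h2 : (2 : ℝ) ^ n = ∏ _i : Fin n, (2 : ℝ) := by simp
    rw [h2, ← Finset.prod_div_distrib]
    refine Finset.prod_congr rfl fun i _ => ?_
    rw [show (Finset.univ : Finset ℤˣ) = {1, -1} from rfl, Finset.sum_pair (by decide),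
      Real.cosh_eq]
    simp
  rw [e, Finset.mul_sum, Finset.sum_div, Real.exp_sum]
  refine Finset.prod_le_prod (fun i _ => (Real.cosh_pos _).le) fun i _ => ?_
  rw [← mul_pow]
  exact Real.cosh_le_exp_half_sq _

lemma mean_coord (i : Fin n) : mean (fun x : Cube n => coord x i) = 0 := by
  have := mean_walsh_mul_walsh {i} (∅ : Finset (Fin n))
  simpa [walsh] using this

/-- If every halfspace has covariance at most `D` with `f`, then the first-degree weight of `f` is
small. The halfspaces used are the thresholds of the degree-one part of `f`. -/
lemma sqrt_fourierWeight_le {f : Cube n → ℝ} (hf : ∀ x, |f x - mean f| ≤ 1) {T D : ℝ}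
    (hT : 1 ≤ T) (hw : 0 < fourierWeight 1 f)
    (hD : ∀ g : Cube n → ℝ, IsHalfspace g → cov f g ≤ D) :
    Real.sqrt (fourierWeight 1 f) ≤ 2 * T * D + 2 * Real.exp (-T ^ 2 / 2) := by
  set s := Real.sqrt (fourierWeight 1 f) with hs
  have hs0 : 0 < s := Real.sqrt_pos.2 hw
  have hss : ∑ i, fourierCoeff f {i} ^ 2 = s * s := by
    rw [← fourierWeight_one, hs, Real.mul_self_sqrt hw.le]
  set a : Fin n → ℝ := fun i => fourierCoeff f {i} / s with ha
  have ha1 : ∑ i, a i ^ 2 = 1 := by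
    simp only [ha, div_pow]
    rw [← Finset.sum_div, hss]
    field_simp
  set Z : Cube n → ℝ := fun x => ∑ i, a i * coord x i with hZ
  have hcov : cov f Z = s := by
    have h1 : mean Z = 0 := by
      simp only [hZ, mean_sum, mean_const_mul, mean_coord, mul_zero, Finset.sum_const_zero]
    have h2 : mean (fun x => f x * Z x) = s := by
      have : ∀ x, f x * Z x = ∑ i, a i * (f x * ∏ j ∈ {i}, coord x j) := by
        intro x
        rw [hZ, Finset.mul_sum]
        refine Finset.sum_congr rfl fun i _ => ?_
        rw [Finset.prod_singleton]; ring
      simp only [this, mean_sum, mean_const_mul]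
      change ∑ i, a i * fourierCoeff f {i} = s
      have : ∀ i, a i * fourierCoeff f {i} = fourierCoeff f {i} ^ 2 / s := fun i => by
        rw [ha]; ring
      simp only [this]
      rw [← Finset.sum_div, hss]
      field_simp
    rw [cov, h1, h2, mul_zero, sub_zero]
  have hthr := cov_le_of_threshold_le hf Z (T := T) (D := D) (by linarith) fun t =>
    hD _ ⟨a, t, fun x => ⟨fun h => if_pos h, fun h => if_neg h⟩⟩
  rw [hcov] at hthr
  have htail : mean (fun x => |Z x - max (-T) (min (Z x) T)|) ≤ 2 * Real.exp (-T ^ 2 / 2) := by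
    refine (mean_mono fun x => abs_sub_truncate_le (Z x) hT).trans ?_
    rw [mean_const_mul, mean_add]
    have h1 := mean_exp_le a T
    have h2 := mean_exp_le a (-T)
    rw [ha1] at h1 h2
    rw [neg_sq] at h2
    calc Real.exp (-T ^ 2) * (mean (fun x => Real.exp (T * Z x))
          + mean (fun x => Real.exp (-T * Z x)))
        ≤ Real.exp (-T ^ 2) * (Real.exp (T ^ 2 * 1 / 2) + Real.exp (T ^ 2 * 1 / 2)) := by
          gcongr
      _ = 2 * (Real.exp (-T ^ 2) * Real.exp (T ^ 2 * 1 / 2)) := by ring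
      _ = 2 * Real.exp (-T ^ 2 / 2) := by
          rw [← Real.exp_add]; congr 2; ring
  linarith

/-! ### Choice of constants -/

lemma mean_sq_of_isBoolean {f : Cube n → ℝ} (hf : IsBoolean f) :
    mean (fun x => f x ^ 2) = mean f := by
  congr 1
  funext x
  rcases hf x with h | h <;> simp [h]

lemma log_two_le_log_inv_mean {μ : ℝ} (h0 : 0 < μ) (h1 : μ ≤ 1 / 2) :
    Real.log 2 ≤ Real.log (1 / μ) := by
  refine Real.log_le_log two_pos ?_
  rw [le_div_iff₀ h0]
  linarith

/-- The lower bound for the first-degree weight. The exponent is chosen of order `log (1 / E f)`, so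
that the noise is still hypercontractive, while `(E f) ^ (1 / m)` is bounded below. -/
lemma fourierWeight_ge {f : Cube n → ℝ} (hB : IsBoolean f) (hf : Monotone f) (h0 : 0 < mean f)
    (h1 : mean f ≤ 1 / 2) {κ θ : ℝ} (hθ0 : 0 < θ) (hθ1 : θ ≤ 1) (hθκ : 2 * θ ≤ κ)
    (hs : κ * mean f ^ 2 ≤ noiseStability (Real.log 2 / 10 / Real.log (1 / mean f)) f) :
    θ ^ 2 / 4 * (mean f ^ 2 * Real.log (1 / mean f)) ≤ fourierWeight 1 f := by
  have hlog := log_two_le_log_inv_mean h0 h1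
  have hl2 : (1 / 2 : ℝ) < Real.log 2 := by linarith [Real.log_two_gt_d9]
  have hl2' : Real.log 2 < 1 := by linarith [Real.log_two_lt_d9]
  set L := Real.log (1 / mean f) with hL
  set μ := mean f with hμ
  have hL0 : 0 < L := by linarith
  by_contra! hw
  set w := fourierWeight 1 f with hwdef
  have hw0 : 0 ≤ w := by rw [hwdef, fourierWeight_one]; positivity
  obtain ⟨m, hm1, hm2⟩ : ∃ m : ℕ, L / Real.log 2 ≤ m ∧ (m : ℝ) < L / Real.log 2 + 1 :=
    ⟨⌈L / Real.log 2⌉₊, Nat.le_ceil _, Nat.ceil_lt_add_one (by positivity)⟩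
  have hLl : 1 ≤ L / Real.log 2 := (one_le_div (by linarith)).2 hlog
  have hm0 : m ≠ 0 := by
    rintro rfl
    norm_num at hm1
    linarith
  have hκ : 0 < κ := by linarith
  have hρm : 2 * (Real.log 2 / 10 / L) * (2 * m + 1) ≤ 1 := by
    have : 2 * (Real.log 2 / 10 / L) * (5 * (L / Real.log 2)) = 1 := by
      field_simp; norm_num
    rw [← this]
    have : 0 ≤ 2 * (Real.log 2 / 10 / L) := by positivity
    gcongr
    linarith
  have hS : 0 < κ * μ ^ 2 := by positivity
  have main := noiseStability_pow_le hf (ρ := Real.log 2 / 10 / L) (by positivity) hm0 hρm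
    (hS.le.trans hs)
  rw [mean_sq_of_isBoolean hB] at main
  have main2 : (κ * μ ^ 2) ^ (m + 1) ≤ (1 / L) ^ (m + 1) *
      ((θ ^ 2 / 4 * (μ ^ 2 * L)) ^ m * μ) := by
    refine (pow_le_pow_left₀ hS.le hs _).trans (main.trans ?_)
    have : 2 * (Real.log 2 / 10 / L) ≤ 1 / L := by
      rw [div_div, mul_div_assoc', div_le_div_iff₀ (by positivity) hL0]
      nlinarith
    gcongr
  have main3 : κ ^ (m + 1) * μ * L ≤ (θ ^ 2 / 4) ^ m := by
    have e1 : (1 / L) ^ (m + 1) * ((θ ^ 2 / 4 * (μ ^ 2 * L)) ^ m * μ)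
        = (θ ^ 2 / 4) ^ m * (μ ^ (2 * m + 1) / L) := by
      rw [mul_pow (θ ^ 2 / 4), mul_pow (μ ^ 2), one_div, inv_pow]
      field_simp
      ring
    have e2 : (κ * μ ^ 2) ^ (m + 1) = κ ^ (m + 1) * μ * L * (μ ^ (2 * m + 1) / L) := by
      field_simp
      ring
    rw [e1, e2] at main2
    exact le_of_mul_le_mul_right main2 (by positivity)
  have hμm : (1 / 2 : ℝ) ^ (m + 1) ≤ μ := by
    have h2 : L ≤ m * Real.log 2 := (div_le_iff₀ (by linarith)).1 hm1
    have h3 : L ≤ Real.log (2 ^ m) := by rwa [Real.log_pow]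
    have h4 : 1 / μ ≤ 2 ^ m := (Real.log_le_log_iff (by positivity) (by positivity)).1 h3
    calc (1 / 2 : ℝ) ^ (m + 1) ≤ (1 / 2 : ℝ) ^ m :=
          pow_le_pow_of_le_one (by norm_num) (by norm_num) (Nat.le_succ m)
      _ = 1 / 2 ^ m := by rw [div_pow, one_pow]
      _ ≤ μ := by rwa [div_le_comm₀ (by positivity) h0]
  have low : θ ^ (m + 1) / 2 ≤ κ ^ (m + 1) * μ * L := by
    calc θ ^ (m + 1) / 2 = (2 * θ) ^ (m + 1) * (1 / 2) ^ (m + 1) * (1 / 2) := by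
          rw [← mul_pow]; ring_nf
      _ ≤ κ ^ (m + 1) * μ * L := by
          gcongr
          linarith
  have up : (θ ^ 2 / 4) ^ m ≤ θ ^ (m + 1) / 4 := by
    rw [div_pow, ← pow_mul]
    have a1 : θ ^ (2 * m) ≤ θ ^ (m + 1) := pow_le_pow_of_le_one hθ0.le hθ1 (by omega)
    have a2 : (4 : ℝ) ≤ 4 ^ m := le_self_pow₀ (by norm_num) hm0
    gcongr
  have : 0 < θ ^ (m + 1) := by positivity
  linarith

/-- The halfspace, from the lower bound on the first-degree weight. The truncation height is
`√(2 (p + 1) log (1 / E f))`, so that the tail is `(E f) ^ (p + 1)`. -/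
lemma exists_halfspace {f : Cube n → ℝ} (hB : IsBoolean f) (h0 : 0 < mean f)
    (h1 : mean f ≤ 1 / 2) {b : ℝ} (hb : 0 < b) {p : ℕ} (hp : (1 / 2 : ℝ) ^ p ≤ b / 16)
    (hw : b ^ 2 * (mean f ^ 2 * Real.log (1 / mean f)) ≤ fourierWeight 1 f) :
    ∃ g : Cube n → ℝ, IsHalfspace g ∧
      b / (8 * Real.sqrt (2 * (p + 1))) * mean f ≤ cov f g := by
  have hlog := log_two_le_log_inv_mean h0 h1
  have hl2 : (1 / 2 : ℝ) < Real.log 2 := by linarith [Real.log_two_gt_d9]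
  set L := Real.log (1 / mean f) with hL
  set μ := mean f with hμ
  have hL0 : 0 < L := by linarith
  by_contra! hg
  set q := Real.sqrt (2 * (p + 1)) with hq
  have hq0 : 0 < q := Real.sqrt_pos.2 (by positivity)
  set r := Real.sqrt L with hr
  have hr0 : 0 < r := Real.sqrt_pos.2 hL0
  have hr2 : r ^ 2 = L := Real.sq_sqrt hL0.le
  have hq2 : q ^ 2 = 2 * (p + 1) := Real.sq_sqrt (by positivity)
  have hp0 : (0 : ℝ) ≤ p := Nat.cast_nonneg p
  have hr1 : 1 / 2 ≤ r := by nlinarith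
  have hT : 1 ≤ q * r := by
    have : 1 ≤ (q * r) ^ 2 := by
      rw [mul_pow, hr2, hq2]
      nlinarith
    nlinarith [mul_pos hq0 hr0]
  have hf1 : ∀ x, |f x - μ| ≤ 1 := by
    intro x
    rw [abs_le]
    rcases hB x with h | h <;> rw [h] <;> constructor <;> linarith
  have hwpos : 0 < fourierWeight 1 f := lt_of_lt_of_le (by positivity) hw
  have key := sqrt_fourierWeight_le hf1 hT hwpos fun g hgh => (hg g hgh).le
  have hlow : b * μ * r ≤ Real.sqrt (fourierWeight 1 f) := by
    refine Real.le_sqrt_of_sq_le ?_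
    rw [mul_pow, hr2, mul_pow, mul_assoc]
    exact hw
  have e1 : 2 * (q * r) * (b / (8 * q) * μ) = b * μ * r / 4 := by
    field_simp
    norm_num
  have e2 : Real.exp (-(q * r) ^ 2 / 2) = μ ^ (p + 1) := by
    rw [mul_pow, hr2, hq2, hL, one_div, Real.log_inv,
      show -(2 * ((p : ℝ) + 1) * -Real.log μ) / 2 = ((p + 1 : ℕ) : ℝ) * Real.log μ by
        push_cast; ring, Real.exp_nat_mul, Real.exp_log h0]
  have e3 : μ ^ (p + 1) ≤ b / 16 * μ := by
    rw [pow_succ]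
    gcongr
    exact (pow_le_pow_left₀ h0.le h1 p).trans hp
  rw [e1, e2] at key
  have hbμ : 0 < b * μ := by positivity
  nlinarith [mul_le_mul_of_nonneg_left hr1 hbμ.le]

end BooleanCube

theorem proposition6 :
    ∃ c : ℝ, 0 < c ∧ c ≤ Real.log 2 ∧
      ∀ κ : ℝ, 0 < κ →
        ∃ c₁ : ℝ, 0 < c₁ ∧ ∃ c₂ : ℝ, 0 < c₂ ∧
          ∀ (n : ℕ) (f : BooleanCube.Cube n → ℝ),
            BooleanCube.IsBoolean f → Monotone f →
            0 < BooleanCube.mean f → BooleanCube.mean f ≤ 1 / 2 →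
            BooleanCube.noiseStability (c / Real.log (1 / BooleanCube.mean f)) f
              ≥ κ * BooleanCube.mean f ^ 2 →
            BooleanCube.fourierWeight 1 f
                ≥ c₁ * (BooleanCube.mean f ^ 2 * Real.log (1 / BooleanCube.mean f)) ∧
              ∃ g : BooleanCube.Cube n → ℝ, BooleanCube.IsHalfspace g ∧
                BooleanCube.cov f g ≥ c₂ * BooleanCube.mean f := by
  have hl2 : 0 < Real.log 2 := Real.log_pos one_lt_two
  refine ⟨Real.log 2 / 10, by positivity, by linarith, fun κ hκ => ?_⟩
  obtain ⟨θ, hθ0, hθ1, hθκ⟩ : ∃ θ : ℝ, 0 < θ ∧ θ ≤ 1 ∧ 2 * θ ≤ κ :=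
    ⟨min 1 (κ / 2), lt_min one_pos (by positivity), min_le_left _ _, by
      linarith [min_le_right 1 (κ / 2)]⟩
  obtain ⟨p, hp⟩ := exists_pow_lt_of_lt_one (show 0 < θ / 2 / 16 by positivity)
    (show (1 / 2 : ℝ) < 1 by norm_num)
  refine ⟨θ ^ 2 / 4, by positivity, θ / 2 / (8 * Real.sqrt (2 * (p + 1))), by positivity,
    fun n f hB hf h0 h1 hs => ?_⟩
  have hw := BooleanCube.fourierWeight_ge hB hf h0 h1 hθ0 hθ1 hθκ hs
  refine ⟨hw, BooleanCube.exists_halfspace hB h0 h1 (by positivity) hp.le ?_⟩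
  rwa [div_pow, show (2 : ℝ) ^ 2 = 4 by norm_num]
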